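/- Let $n\ge 0$ and let $a=\{a_I : I\in\mathbb N^n,\ |I|\ge 2\}$ be a set of commuting variables, where $\mathbb N=\{0,1,2,\dots\}$ and $|I|=I_1+\cdots+I_n$. Let $$P(z)=\sum_{I\in\mathbb N^n,\ |I|\ge 2} a_I z^I\in\mathbb C[a][[z]],\qquad z=(z_1,\dots,z_n),$$ be the universal formal power series of order at least $2$. Let $\Delta=\sum_{i=1}^n \partial^2/\partial z_i^2$ and $\operatorname{Hes}(P)=\left(\partial^2P/\partial z_i\partial z_j\right)_{1\le i,j\le n}$, and for $m\ge 1$ put $$u_m(P)=\operatorname{Tr}\,\operatorname{Hes}(P)^m,\qquad v_m(P)=\Delta^m(P^m).$$ For $k\ge 0$ let $\mathcal U_k(P)$ (resp. $\mathcal V_k(P)$) be the ideal of $\mathbb C[a][[z]]$ generated by the series $u_m(P)$ (resp. $v_m(P)$), $1\le m\le k$, together with all their partial derivatives of any order with respect to $z_1,\dots,z_n$. Let $\widetilde{\mathcal U}_k(P)$ (resp. $\widetilde{\mathcal V}_k(P)$) be the ideal of $\mathbb C[a]$ generated by all coefficients, as power series in $z$, of the $u_m(P)$ (resp. $v_m(P)$),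 $1\le m\le k$. Then for every $k$, $$\mathcal U_k(P)=\mathcal V_k(P)\quad\text{and}\quad \widetilde{\mathcal U}_k(P)=\widetilde{\mathcal V}_k(P).$$ -/

import Mathlib

namespace HessianNilpotent

noncomputable section

/-- The index set of the variables `a_I`: multi-indices `I ∈ ℕⁿ` with `|I| ≥ 2`. -/
abbrev CoeffIndex (n : ℕ) : Type := {I : Fin n →₀ ℕ // 2 ≤ I.degree}

/-- The polynomial ring `ℂ[a]` in the commuting variables `a_I`, `|I| ≥ 2`. -/
abbrev CoeffRing (n : ℕ) : Type := MvPolynomial (CoeffIndex n) ℂ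

/-- The universal formal power series `P(z) = ∑_{|I| ≥ 2} a_I z^I` in `ℂ[a][[z₁, …, zₙ]]`,
given by its coefficients. -/
def universalSeries (n : ℕ) : MvPowerSeries (Fin n) (CoeffRing n) :=
  fun I => if h : 2 ≤ I.degree then MvPolynomial.X ⟨I, h⟩ else 0

variable {n : ℕ} {R : Type*} [CommRing R]

/-- The Laplace operator `Δ = ∑ i, ∂²/∂zᵢ²`. -/
def laplacian (f : MvPowerSeries (Fin n) R) : MvPowerSeries (Fin n) R :=
  ∑ i, MvPowerSeries.pderiv R i (MvPowerSeries.pderiv R i f)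

/-- The Hessian matrix `(∂²f/∂zᵢ∂zⱼ)`. -/
def hessian (f : MvPowerSeries (Fin n) R) : Matrix (Fin n) (Fin n) (MvPowerSeries (Fin n) R) :=
  Matrix.of fun i j => MvPowerSeries.pderiv R i (MvPowerSeries.pderiv R j f)

/-- `u_m(f) = Tr Hes^m(f)`, the trace of the `m`-th power of the Hessian matrix. -/
def traceHessianPow (f : MvPowerSeries (Fin n) R) (m : ℕ) : MvPowerSeries (Fin n) R :=
  (hessian f ^ m).trace

/-- `v_m(f) = Δ^m (f^m)`. -/
def laplacianPow (f : MvPowerSeries (Fin n) R) (m : ℕ) : MvPowerSeries (Fin n) R :=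
  laplacian^[m] (f ^ m)

/-- The iterated partial derivative along a finite list of coordinates; the empty list gives `f`. -/
def iteratedPDeriv (l : List (Fin n)) (f : MvPowerSeries (Fin n) R) : MvPowerSeries (Fin n) R :=
  l.foldr (fun i g => MvPowerSeries.pderiv R i g) f

/-- The differential ideal of `R[[z]]` generated by `w 1, …, w k`: the ideal generated by these
series and all their partial derivatives of any order. -/
def differentialIdeal (w : ℕ → MvPowerSeries (Fin n) R) (k : ℕ) :
    Ideal (MvPowerSeries (Fin n) R) :=
  Ideal.span {g | ∃ m, 1 ≤ m ∧ m ≤ k ∧ ∃ l : List (Fin n), g = iteratedPDeriv l (w m)}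

/-- The ideal of `R` generated by all coefficients of `w 1, …, w k`. -/
def coeffIdeal (w : ℕ → MvPowerSeries (Fin n) R) (k : ℕ) : Ideal R :=
  Ideal.span {c | ∃ m, 1 ≤ m ∧ m ≤ k ∧ ∃ I : Fin n →₀ ℕ, c = MvPowerSeries.coeff I (w m)}

end

end HessianNilpotent

namespace HessianNilpotent

noncomputable section

open PowerSeries Finset

section DerivationFamily

variable {ι A : Type*} [Fintype ι] [CommRing A] [Algebra ℚ A]

/-! Deform `P` to `Q(t)` with `Q(0) = P` and `2 ∂Q/∂t = ∑ (d l Q)²`. Along the flow `E = ∂/∂t - ∑ d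
l Q • d l` the Hessian `H` of `Q` satisfies `E H = H²` (`transport_hessian`), hence `E Tr H^m = m Tr
H^(m+1)`. Modulo a differential ideal containing `u_1, …, u_k`, comparing coefficients of `t` gives
`ΔQ_k ≡ u_(k+1)`, where `Q_k` is the coefficient of `t^k`. The same equation turns `Δ` on powers of
`Q` into `∂/∂t`, so `Δ^k P^(k+1)` is congruent to a nonzero integer times `Q_k`. One more `Δ` makes
`v_(k+1)` a nonzero integer multiple of `u_(k+1)`, and integers are units over `ℚ`. Induction on `k`
gives `trace_hessian_pow_mem_iff` for every differential ideal, which yields both equalities. -/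

/-- The sum of the squares of a finite family of derivations. -/
def derivationLaplacian (d : ι → Derivation ℚ A A) (x : A) : A :=
  ∑ i, d i (d i x)

/-- The matrix of second derivatives with respect to a family of derivations. -/
def derivationHessian (d : ι → Derivation ℚ A A) (x : A) : Matrix ι ι A :=
  Matrix.of fun i j => d i (d j x)

/-! ### Matrices and powers along a Hamilton-Jacobi flow. -/

theorem derivation_matrix_pow [DecidableEq ι] (E : Derivation ℚ A A) {M : Matrix ι ι A}
    (h : M.map E = M ^ 2) (m : ℕ) : (M ^ m).map E = (m : A) • M ^ (m + 1) := by
  have key : ∀ B C : Matrix ι ι A, (B * C).map E = B.map E * C + B * C.map E := by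
    intro B C
    ext i j
    simp only [Matrix.map_apply, Matrix.mul_apply, Matrix.add_apply, map_sum, Derivation.leibniz,
      smul_eq_mul, ← Finset.sum_add_distrib]
    exact Finset.sum_congr rfl fun l _ => by ring
  induction m with
  | zero =>
    ext i j
    by_cases hij : i = j <;> simp [hij]
  | succ m ih =>
    rw [pow_succ, key, ih, h, Matrix.smul_mul, ← pow_succ, ← pow_add, Nat.cast_succ, add_smul,
      one_smul]

theorem derivation_trace_pow [DecidableEq ι] (E : Derivation ℚ A A) {M : Matrix ι ι A}
    (h : M.map E = M ^ 2) (m : ℕ) : E (M ^ m).trace = m * (M ^ (m + 1)).trace := by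
  have := congrArg Matrix.trace (derivation_matrix_pow E h m)
  rw [Matrix.trace_smul, smul_eq_mul] at this
  rw [← this]
  simp [Matrix.trace]

/-- The derivative along the flow of a solution of the Hamilton-Jacobi equation. -/
def transportDerivation (d : ι → Derivation ℚ A A) (T : Derivation ℚ A A) (Q : A) :
    Derivation ℚ A A :=
  T - ∑ l, d l Q • d l

theorem transportDerivation_apply (d : ι → Derivation ℚ A A) (T : Derivation ℚ A A) (Q x : A) :
    transportDerivation d T Q x = T x - ∑ l, d l Q * d l x := by
  have : ∀ s : Finset ι, (∑ l ∈ s, d l Q • d l) x = ∑ l ∈ s, d l Q * d l x := fun s => by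
    classical
    induction s using Finset.induction_on with
    | empty => simp
    | insert l s hl ih => simp [Finset.sum_insert hl, ih]
  rw [transportDerivation, Derivation.sub_apply, this]

theorem isUnit_natCast_of_rat {m : ℕ} (hm : m ≠ 0) : IsUnit (m : A) := by
  have : IsUnit (m : ℚ) := (Nat.cast_ne_zero.mpr hm).isUnit
  simpa using this.map (algebraMap ℚ A)

theorem natCast_mul_mem_iff {I : Ideal A} {m : ℕ} (hm : m ≠ 0) {x : A} :
    (m : A) * x ∈ I ↔ x ∈ I :=
  Ideal.unit_mul_mem_iff_mem I (isUnit_natCast_of_rat hm)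

/-- Applying `d i` and `d j` to the equation produces the third-order terms `d l Q * d i (d j (d l
Q))`, which the transport part cancels; what is left is the square of the Hessian. -/
theorem transport_hessian [DecidableEq ι] (d : ι → Derivation ℚ A A) (T : Derivation ℚ A A)
    (hd : ∀ i j x, d i (d j x) = d j (d i x)) (hT : ∀ i x, T (d i x) = d i (T x)) {Q : A}
    (hQ : 2 * T Q = ∑ l, d l Q ^ 2) :
    (derivationHessian d Q).map (transportDerivation d T Q) = derivationHessian d Q ^ 2 := by
  ext i j
  have h2 : IsUnit (2 : A) := by simpa using isUnit_natCast_of_rat (A := A) two_ne_zero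
  have hij : 2 * T (d i (d j Q)) = 2 * ∑ l, (d i (d l Q) * d j (d l Q) +
      d l Q * d i (d j (d l Q))) := by
    have := congrArg (fun y => d i (d j y)) hQ
    simp only [Derivation.leibniz, smul_eq_mul, map_sum, pow_two, map_add] at this
    have two : ∀ i, d i (2 : A) = 0 := fun i => by simpa using (d i).map_natCast 2
    simp only [two, mul_zero, zero_mul, add_zero, map_zero] at this
    rw [hT, hT, this, Finset.mul_sum]
    exact Finset.sum_congr rfl fun l _ => by ring
  have := h2.mul_left_cancel hij
  rw [Matrix.map_apply, transportDerivation_apply, pow_two, Matrix.mul_apply]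
  simp only [derivationHessian, Matrix.of_apply]
  rw [this, ← Finset.sum_sub_distrib]
  refine Finset.sum_congr rfl fun l _ => ?_
  rw [hd j l Q, hd l i]
  ring

/-- The gradient term `∑ (d l Q)²` in the Laplacian of a power is a time derivative by the equation.
-/
theorem derivationLaplacian_pow (d : ι → Derivation ℚ A A) (T : Derivation ℚ A A) {Q : A}
    (hQ : 2 * T Q = ∑ l, d l Q ^ 2) (j : ℕ) :
    derivationLaplacian d (Q ^ (j + 1)) =
      (j + 1 : ℕ) * (Q ^ j * derivationLaplacian d Q + 2 * T (Q ^ j)) := by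
  have cast : ∀ i (m : ℕ), d i (m : A) = 0 := fun i m => (d i).map_natCast m
  -- At `j = 0` the truncated exponent `j - 1` is harmless, since the factor `j` vanishes.
  have hTQ : 2 * T (Q ^ j) = j * Q ^ (j - 1) * ∑ l, d l Q ^ 2 := by
    rw [← hQ, Derivation.leibniz_pow, smul_eq_mul, nsmul_eq_mul]
    ring
  rw [hTQ, derivationLaplacian, derivationLaplacian, Finset.mul_sum, Finset.mul_sum,
    ← Finset.sum_add_distrib, Finset.mul_sum]
  refine Finset.sum_congr rfl fun l _ => ?_
  simp only [Derivation.leibniz_pow, Derivation.leibniz, smul_eq_mul, nsmul_eq_mul, cast,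
    Nat.add_sub_cancel]
  ring

/-! ### Power series in the time `t` and the formal solution. -/

/-- The derivation of a power series ring acting on the coefficients. -/
def coeffwiseDerivation (D : Derivation ℚ A A) : Derivation ℚ A⟦X⟧ A⟦X⟧ :=
  Derivation.mk'
    { toFun := fun f => PowerSeries.mk fun m => D (coeff m f)
      map_add' := fun f g => by ext m; simp
      map_smul' := fun r f => by ext m; simp }
    fun f g => by
      ext m
      simp only [LinearMap.coe_mk, AddHom.coe_mk, coeff_mk, coeff_mul, map_sum,
        Derivation.leibniz, smul_eq_mul, map_add, Finset.sum_add_distrib]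
      congr 1
      rw [← Finset.Nat.sum_antidiagonal_swap]
      simp

@[simp]
theorem coeff_coeffwiseDerivation (D : Derivation ℚ A A) (f : A⟦X⟧) (m : ℕ) :
    coeff m (coeffwiseDerivation D f) = D (coeff m f) := by
  simp [coeffwiseDerivation]

/-- The derivative of power series as a derivation over `ℚ`. -/
def ratDerivative (A : Type*) [CommRing A] [Algebra ℚ A] : Derivation ℚ A⟦X⟧ A⟦X⟧ :=
  (PowerSeries.derivative A).restrictScalars ℚ

@[simp]
theorem coeff_ratDerivative (f : A⟦X⟧) (m : ℕ) :
    coeff m (ratDerivative A f) = coeff (m + 1) f * (m + 1) :=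
  coeff_derivative f m

/-- The coefficients of the solution of the Hamilton-Jacobi equation
`2 ∂Q/∂t = ∑ l, (d l Q) ^ 2` with initial value `P`. -/
def hamiltonJacobiCoeff (d : ι → Derivation ℚ A A) (P : A) : ℕ → A
  | 0 => P
  | m + 1 => (1 / (2 * (m + 1)) : ℚ) • ∑ p : Fin (m + 1), ∑ l,
      d l (hamiltonJacobiCoeff d P p) * d l (hamiltonJacobiCoeff d P (m - p))
  termination_by m => m
  decreasing_by all_goals omega

theorem exists_hamiltonJacobi (d : ι → Derivation ℚ A A) (P : A) :
    ∃ Q : A⟦X⟧, coeff 0 Q = P ∧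
      2 * ratDerivative A Q = ∑ l, coeffwiseDerivation (d l) Q ^ 2 := by
  refine ⟨PowerSeries.mk (hamiltonJacobiCoeff d P), by simp [hamiltonJacobiCoeff], ?_⟩
  ext m
  rw [two_mul, map_add, ← two_mul, coeff_ratDerivative, coeff_mk, hamiltonJacobiCoeff, map_sum]
  simp only [pow_two, coeff_mul, coeff_coeffwiseDerivation, coeff_mk]
  rw [Finset.sum_comm (s := univ (α := ι)), Finset.Nat.sum_antidiagonal_eq_sum_range_succ_mk, ← Fin.sum_univ_eq_sum_range
    (fun p => ∑ l, d l (hamiltonJacobiCoeff d P p) * d l (hamiltonJacobiCoeff d P (m - p))),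
    Algebra.smul_def]
  set S := ∑ p : Fin (m + 1), ∑ l,
    d l (hamiltonJacobiCoeff d P p) * d l (hamiltonJacobiCoeff d P (m - p))
  have : (2 * (m + 1) : A) * algebraMap ℚ A (1 / (2 * (m + 1))) = 1 := by
    have h : (2 * (m + 1) : A) = algebraMap ℚ A (2 * (m + 1)) := by
      simp only [map_mul, map_add, map_natCast, map_one, map_ofNat]
    rw [h, ← map_mul, mul_one_div_cancel (by positivity), map_one]
  linear_combination S * this

theorem coeff_derivationLaplacian (d : ι → Derivation ℚ A A) (f : A⟦X⟧) (m : ℕ) :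
    coeff m (derivationLaplacian (fun i => coeffwiseDerivation (d i)) f) =
      derivationLaplacian d (coeff m f) := by
  simp [derivationLaplacian]

theorem coeff_zero_trace_hessian_pow [DecidableEq ι] (d : ι → Derivation ℚ A A) (f : A⟦X⟧)
    (m : ℕ) :
    coeff 0 (derivationHessian (fun i => coeffwiseDerivation (d i)) f ^ m).trace =
      (derivationHessian d (coeff 0 f) ^ m).trace := by
  have h : (constantCoeff (R := A)).mapMatrix
      (derivationHessian (fun i => coeffwiseDerivation (d i)) f) =
      derivationHessian d (coeff 0 f) := by
    ext i j
    simp only [derivationHessian, RingHom.mapMatrix_apply, Matrix.map_apply, Matrix.of_apply,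
      ← coeff_zero_eq_constantCoeff_apply, coeff_coeffwiseDerivation]
  rw [← h, ← map_pow, coeff_zero_eq_constantCoeff_apply, RingHom.mapMatrix_apply]
  exact AddMonoidHom.map_trace _ _

theorem derivationLaplacian_mem {d : ι → Derivation ℚ A A} {I : Ideal A}
    (hI : ∀ i, ∀ x ∈ I, d i x ∈ I) {x : A} (hx : x ∈ I) : derivationLaplacian d x ∈ I :=
  I.sum_mem fun i _ => hI i _ (hI i _ hx)

theorem derivationLaplacian_sub (d : ι → Derivation ℚ A A) (x y : A) :
    derivationLaplacian d (x - y) = derivationLaplacian d x - derivationLaplacian d y := by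
  simp [derivationLaplacian]

theorem derivationLaplacian_natCast_mul (d : ι → Derivation ℚ A A) (m : ℕ) (x : A) :
    derivationLaplacian d (m * x) = m * derivationLaplacian d x := by
  simp [derivationLaplacian, ← nsmul_eq_mul, Finset.smul_sum]

/-! ### Time coefficients modulo a differential ideal. -/

section HamiltonJacobi

variable [DecidableEq ι] {d : ι → Derivation ℚ A A} {I : Ideal A} {Q : A⟦X⟧}

/-- The recursion for the coefficients of the traces of the powers of the Hessian matrix of a
solution of the Hamilton-Jacobi equation. -/
theorem coeff_succ_trace_hessian_pow (hd : ∀ i j x, d i (d j x) = d j (d i x))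
    (hQ : 2 * ratDerivative A Q = ∑ l, coeffwiseDerivation (d l) Q ^ 2) (m j : ℕ) :
    (j + 1 : ℕ) *
        coeff (j + 1) (derivationHessian (fun i => coeffwiseDerivation (d i)) Q ^ m).trace =
      ∑ l, ∑ p ∈ antidiagonal j, d l (coeff p.1 Q) *
        d l (coeff p.2 (derivationHessian (fun i => coeffwiseDerivation (d i)) Q ^ m).trace) +
      m * coeff j (derivationHessian (fun i => coeffwiseDerivation (d i)) Q ^ (m + 1)).trace := by
  have hE := derivation_trace_pow _ (transport_hessian (fun i => coeffwiseDerivation (d i))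
    (ratDerivative A) (fun i j x => by ext; simp [hd i j]) (fun i x => by
      ext r
      simp only [coeff_ratDerivative, coeff_coeffwiseDerivation]
      have : d i ((r : A) + 1) = 0 := by
        exact_mod_cast (d i).map_natCast (r + 1)
      rw [Derivation.leibniz, this]
      simp [mul_comm]) hQ) m
  rw [transportDerivation_apply, sub_eq_iff_eq_add] at hE
  have := congrArg (coeff j) hE
  rw [coeff_ratDerivative, map_add, map_sum, ← nsmul_eq_mul, map_nsmul, nsmul_eq_mul] at this
  simp only [coeff_mul, coeff_coeffwiseDerivation] at this
  rw [mul_comm, Nat.cast_succ, this, add_comm]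

/-- The recursion trades one degree in `t` for one power of the Hessian, so its new term keeps `m +
j`; the other terms have smaller degree in `t`. -/
theorem coeff_trace_hessian_pow_mem (hd : ∀ i j x, d i (d j x) = d j (d i x))
    (hI : ∀ i, ∀ x ∈ I, d i x ∈ I)
    (hQ : 2 * ratDerivative A Q = ∑ l, coeffwiseDerivation (d l) Q ^ 2) {k : ℕ}
    (hu : ∀ m, 1 ≤ m → m ≤ k → (derivationHessian d (coeff 0 Q) ^ m).trace ∈ I) (j : ℕ) :
    ∀ m, 1 ≤ m → m + j ≤ k →
      coeff j (derivationHessian (fun i => coeffwiseDerivation (d i)) Q ^ m).trace ∈ I := by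
  induction j using Nat.strong_induction_on with
  | _ j ih =>
    intro m hm hmj
    cases j with
    | zero =>
      rw [coeff_zero_trace_hessian_pow]
      exact hu m hm hmj
    | succ j =>
      rw [← natCast_mul_mem_iff j.succ_ne_zero, Nat.succ_eq_add_one,
        coeff_succ_trace_hessian_pow hd hQ]
      refine I.add_mem (I.sum_mem fun l _ => I.sum_mem fun p hp => ?_)
        (I.mul_mem_left _ (ih j (by omega) _ (by omega) (by omega)))
      have := Finset.HasAntidiagonal.mem_antidiagonal.mp hp
      exact I.mul_mem_left _ (hI _ _ (ih _ (by omega) m hm (by omega)))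

/-- On the borderline `m + j = k + 1` only the last term of the recursion survives modulo `I`; its
factors multiply to `m (m + 1) ⋯ (m + j - 1)`. -/
theorem coeff_trace_hessian_pow_sub_mem (hd : ∀ i j x, d i (d j x) = d j (d i x))
    (hI : ∀ i, ∀ x ∈ I, d i x ∈ I)
    (hQ : 2 * ratDerivative A Q = ∑ l, coeffwiseDerivation (d l) Q ^ 2) {k : ℕ}
    (hu : ∀ m, 1 ≤ m → m ≤ k → (derivationHessian d (coeff 0 Q) ^ m).trace ∈ I) (j : ℕ) :
    ∀ m, 1 ≤ m → m + j = k + 1 →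
      (j.factorial : A) *
          coeff j (derivationHessian (fun i => coeffwiseDerivation (d i)) Q ^ m).trace -
        (m.ascFactorial j : A) * (derivationHessian d (coeff 0 Q) ^ (k + 1)).trace ∈ I := by
  induction j with
  | zero =>
    rintro m - hm
    rw [show m = k + 1 from hm]
    rw [coeff_zero_trace_hessian_pow]
    simp
  | succ j ih =>
    intro m hm hmj
    have h := ih (m + 1) (by omega) (by omega)
    rw [Nat.factorial_succ, mul_comm (j + 1), Nat.cast_mul, mul_assoc,
      coeff_succ_trace_hessian_pow hd hQ, Nat.ascFactorial_succ, ← Nat.succ_ascFactorial,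
      mul_add, Nat.cast_mul]
    have hsum : ∑ l, ∑ p ∈ antidiagonal j, d l (coeff p.1 Q) * d l (coeff p.2
        (derivationHessian (fun i => coeffwiseDerivation (d i)) Q ^ m).trace) ∈ I := by
      refine I.sum_mem fun l _ => I.sum_mem fun p hp => I.mul_mem_left _ (hI _ _ ?_)
      have := Finset.HasAntidiagonal.mem_antidiagonal.mp hp
      exact coeff_trace_hessian_pow_mem hd hI hQ hu p.2 m hm (by omega)
    convert I.add_mem (I.mul_mem_left (j.factorial : A) hsum) (I.mul_mem_left (m : A) h) using 1
    ring

/-- This is the borderline case `m = 1`, where both constants equal `k!` and the trace is the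
Laplacian. -/
theorem derivationLaplacian_coeff_sub_mem (hd : ∀ i j x, d i (d j x) = d j (d i x))
    (hI : ∀ i, ∀ x ∈ I, d i x ∈ I)
    (hQ : 2 * ratDerivative A Q = ∑ l, coeffwiseDerivation (d l) Q ^ 2) {k : ℕ}
    (hu : ∀ m, 1 ≤ m → m ≤ k → (derivationHessian d (coeff 0 Q) ^ m).trace ∈ I) :
    derivationLaplacian d (coeff k Q) -
      (derivationHessian d (coeff 0 Q) ^ (k + 1)).trace ∈ I := by
  have h := coeff_trace_hessian_pow_sub_mem hd hI hQ hu k 1 le_rfl (add_comm 1 k)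
  rw [Nat.one_ascFactorial, ← mul_sub, natCast_mul_mem_iff k.factorial_ne_zero, pow_one] at h
  rwa [← coeff_derivationLaplacian]

/-- Each Laplacian lowers the power of `Q` by one and raises the degree in `t` by one, with factor
`2 (i + 1) (k + 1 - i)`. The remaining term involves `ΔQ` only in degrees below `k`, hence lies in
`I`. -/
theorem iterate_derivationLaplacian_pow_sub_mem (hd : ∀ i j x, d i (d j x) = d j (d i x))
    (hI : ∀ i, ∀ x ∈ I, d i x ∈ I)
    (hQ : 2 * ratDerivative A Q = ∑ l, coeffwiseDerivation (d l) Q ^ 2) {k : ℕ}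
    (hu : ∀ m, 1 ≤ m → m ≤ k → (derivationHessian d (coeff 0 Q) ^ m).trace ∈ I) (i : ℕ)
    (hi : i ≤ k) :
    (derivationLaplacian d)^[i] (coeff 0 Q ^ (k + 1)) -
      (2 ^ i * i.factorial * (k + 1).descFactorial i : ℕ) * coeff i (Q ^ (k + 1 - i)) ∈ I := by
  induction i with
  | zero => simp
  | succ i ih =>
    have h := derivationLaplacian_mem hI (ih (by omega))
    rw [derivationLaplacian_sub, derivationLaplacian_natCast_mul,
      ← Function.iterate_succ_apply' (derivationLaplacian d), ← coeff_derivationLaplacian] at h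
    obtain ⟨j, hj⟩ : ∃ j, k + 1 - i = j + 1 := ⟨k - i, by omega⟩
    have hlap := congrArg (coeff i) (derivationLaplacian_pow _ _ hQ j)
    rw [← nsmul_eq_mul, map_nsmul, nsmul_eq_mul, map_add, two_mul, map_add, ← two_mul,
      coeff_ratDerivative] at hlap
    have hmem : coeff i (Q ^ j *
        derivationLaplacian (fun l => coeffwiseDerivation (d l)) Q) ∈ I := by
      rw [coeff_mul]
      refine I.sum_mem fun p hp => I.mul_mem_left _ ?_
      have := Finset.HasAntidiagonal.mem_antidiagonal.mp hp
      simpa [Matrix.trace, derivationHessian, derivationLaplacian] using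
        coeff_trace_hessian_pow_mem hd hI hQ hu p.2 1 le_rfl (by omega)
    rw [hj, hlap] at h
    have hj' : k + 1 - (i + 1) = j := by omega
    rw [hj', Nat.descFactorial_succ, Nat.factorial_succ, hj]
    convert I.add_mem h (I.mul_mem_left
      ((2 ^ i * i.factorial * (k + 1).descFactorial i * (j + 1) : ℕ) : A) hmem) using 1
    push_cast
    ring

end HamiltonJacobi

/-- Modulo a differential ideal containing the traces of the lower powers of the Hessian matrix,
`Δ^(k+1) P^(k+1)` is a nonzero multiple of the trace of the `(k+1)`-st power. -/
theorem derivationLaplacian_pow_sub_trace_mem [DecidableEq ι] {d : ι → Derivation ℚ A A}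
    (hd : ∀ i j x, d i (d j x) = d j (d i x)) {I : Ideal A} (hI : ∀ i, ∀ x ∈ I, d i x ∈ I)
    (P : A) {k : ℕ} (hu : ∀ m, 1 ≤ m → m ≤ k → (derivationHessian d P ^ m).trace ∈ I) :
    (derivationLaplacian d)^[k + 1] (P ^ (k + 1)) -
      (2 ^ k * k.factorial * (k + 1).factorial : ℕ) *
        (derivationHessian d P ^ (k + 1)).trace ∈ I := by
  obtain ⟨Q, rfl, hQ⟩ := exists_hamiltonJacobi d P
  -- At `i = k` only the first power of `Q` is left, so one more Laplacian gives `ΔQ_k`.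
  have h := derivationLaplacian_mem hI
    (iterate_derivationLaplacian_pow_sub_mem hd hI hQ hu k le_rfl)
  have hf : (k + 1).descFactorial k = (k + 1).factorial := by
    simpa using (Nat.factorial_mul_descFactorial (Nat.le_succ k))
  rw [derivationLaplacian_sub, derivationLaplacian_natCast_mul, ← Function.iterate_succ_apply' (derivationLaplacian d),
    hf, Nat.add_sub_cancel_left, pow_one] at h
  convert I.add_mem h (I.mul_mem_left
    ((2 ^ k * k.factorial * (k + 1).factorial : ℕ) : A)
    (derivationLaplacian_coeff_sub_mem hd hI hQ hu)) using 1
  ring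

/-- A differential ideal contains the traces of the powers of the Hessian matrix up to the order
`k` if and only if it contains the `Δ^m P^m`, `m ≤ k`. -/
theorem trace_hessian_pow_mem_iff [DecidableEq ι] {d : ι → Derivation ℚ A A}
    (hd : ∀ i j x, d i (d j x) = d j (d i x)) {I : Ideal A} (hI : ∀ i, ∀ x ∈ I, d i x ∈ I)
    (P : A) (k : ℕ) :
    (∀ m, 1 ≤ m → m ≤ k → (derivationHessian d P ^ m).trace ∈ I) ↔
      ∀ m, 1 ≤ m → m ≤ k → (derivationLaplacian d)^[m] (P ^ m) ∈ I := by
  induction k with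
  | zero => exact ⟨fun _ m h1 h2 => by omega, fun _ m h1 h2 => by omega⟩
  | succ k ih =>
    have split : ∀ p : ℕ → Prop, (∀ m, 1 ≤ m → m ≤ k + 1 → p m) ↔
        (∀ m, 1 ≤ m → m ≤ k → p m) ∧ p (k + 1) := fun p =>
      ⟨fun h => ⟨fun m h1 h2 => h m h1 (by omega), h _ (by omega) le_rfl⟩, fun h m h1 h2 => by
        rcases Nat.le_succ_iff.mp h2 with h2 | rfl
        exacts [h.1 m h1 h2, h.2]⟩
    rw [split, split, ← ih]
    refine and_congr_right fun hu => ?_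
    have h := derivationLaplacian_pow_sub_trace_mem hd hI P hu
    rw [← natCast_mul_mem_iff (m := 2 ^ k * k.factorial * (k + 1).factorial) (by positivity)]
    exact ⟨fun h' => by simpa using I.add_mem h h', fun h' => by simpa using I.sub_mem h' h⟩

end DerivationFamily

/-! ### Application to the two kinds of ideals. -/

section MvPowerSeries

variable {n : ℕ} {R : Type*} [CommRing R]

theorem pderiv_comm (i j : Fin n) (f : MvPowerSeries (Fin n) R) :
    MvPowerSeries.pderiv R i (MvPowerSeries.pderiv R j f) =
      MvPowerSeries.pderiv R j (MvPowerSeries.pderiv R i f) := by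
  rcases eq_or_ne i j with rfl | hij
  · rfl
  · ext I
    simp only [MvPowerSeries.coeff_pderiv, Finsupp.add_apply, Finsupp.single_eq_of_ne hij,
      Finsupp.single_eq_of_ne hij.symm, add_right_comm I, add_zero]
    ring

theorem traceHessianPow_mem_iff [Algebra ℚ R] {I : Ideal (MvPowerSeries (Fin n) R)}
    (hI : ∀ i, ∀ f ∈ I, MvPowerSeries.pderiv R i f ∈ I) (P : MvPowerSeries (Fin n) R) (k : ℕ) :
    (∀ m, 1 ≤ m → m ≤ k → traceHessianPow P m ∈ I) ↔
      ∀ m, 1 ≤ m → m ≤ k → laplacianPow P m ∈ I :=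
  trace_hessian_pow_mem_iff (d := fun i => (MvPowerSeries.pderiv R i).restrictScalars ℚ)
    pderiv_comm hI P k

theorem pderiv_mem_differentialIdeal (w : ℕ → MvPowerSeries (Fin n) R) (k : ℕ) (i : Fin n)
    (f : MvPowerSeries (Fin n) R) (hf : f ∈ differentialIdeal w k) :
    MvPowerSeries.pderiv R i f ∈ differentialIdeal w k := by
  induction hf using Submodule.span_induction with
  | mem f hf =>
    obtain ⟨m, h1, h2, l, rfl⟩ := hf
    exact Ideal.subset_span ⟨m, h1, h2, i :: l, rfl⟩
  | zero => simp
  | add f g _ _ hf hg => simpa using Ideal.add_mem _ hf hg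
  | smul c f hf' hf =>
    rw [smul_eq_mul, Derivation.leibniz]
    exact Ideal.add_mem _ (Ideal.mul_mem_left _ _ hf)
      (Ideal.mul_mem_right _ _ hf')

theorem mem_differentialIdeal {w : ℕ → MvPowerSeries (Fin n) R} {k m : ℕ} (h1 : 1 ≤ m)
    (h2 : m ≤ k) : w m ∈ differentialIdeal w k :=
  Ideal.subset_span ⟨m, h1, h2, [], rfl⟩

theorem differentialIdeal_le {w : ℕ → MvPowerSeries (Fin n) R} {k : ℕ}
    {I : Ideal (MvPowerSeries (Fin n) R)} (hI : ∀ i, ∀ f ∈ I, MvPowerSeries.pderiv R i f ∈ I)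
    (h : ∀ m, 1 ≤ m → m ≤ k → w m ∈ I) : differentialIdeal w k ≤ I := by
  refine Ideal.span_le.mpr ?_
  rintro _ ⟨m, h1, h2, l, rfl⟩
  induction l with
  | nil => exact h m h1 h2
  | cons i l ih => exact hI i _ ih

/-- The ideal of the power series all of whose coefficients lie in a given ideal. -/
def coeffwiseIdeal (n : ℕ) (J : Ideal R) : Ideal (MvPowerSeries (Fin n) R) where
  carrier := {f | ∀ I, MvPowerSeries.coeff I f ∈ J}
  add_mem' hf hg I := by simpa using J.add_mem (hf I) (hg I)
  zero_mem' I := by simp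
  smul_mem' c f hf I := by
    rw [smul_eq_mul, MvPowerSeries.coeff_mul]
    exact J.sum_mem fun p _ => J.mul_mem_left _ (hf _)

theorem pderiv_mem_coeffwiseIdeal (J : Ideal R) (i : Fin n) (f : MvPowerSeries (Fin n) R)
    (hf : f ∈ coeffwiseIdeal n J) : MvPowerSeries.pderiv R i f ∈ coeffwiseIdeal n J := fun I => by
  rw [MvPowerSeries.coeff_pderiv]
  exact J.mul_mem_right _ (hf _)

theorem coeffIdeal_le_iff {w : ℕ → MvPowerSeries (Fin n) R} {k : ℕ} {J : Ideal R} :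
    coeffIdeal w k ≤ J ↔ ∀ m, 1 ≤ m → m ≤ k → w m ∈ coeffwiseIdeal n J := by
  rw [coeffIdeal, Ideal.span_le]
  constructor
  · exact fun h m h1 h2 I => h ⟨m, h1, h2, I, rfl⟩
  · rintro h _ ⟨m, h1, h2, I, rfl⟩
    exact h m h1 h2 I

/-- Each ideal is stable under derivatives and contains its own generators, so the equivalence puts
the generators of the other into it. -/
theorem differentialIdeal_traceHessianPow [Algebra ℚ R] (P : MvPowerSeries (Fin n) R) (k : ℕ) :
    differentialIdeal (traceHessianPow P) k = differentialIdeal (laplacianPow P) k := by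
  apply le_antisymm
  · have hI := pderiv_mem_differentialIdeal (laplacianPow P) k
    exact differentialIdeal_le hI
      ((traceHessianPow_mem_iff hI P k).mpr fun m => mem_differentialIdeal)
  · have hI := pderiv_mem_differentialIdeal (traceHessianPow P) k
    exact differentialIdeal_le hI
      ((traceHessianPow_mem_iff hI P k).mp fun m => mem_differentialIdeal)

theorem coeffIdeal_traceHessianPow [Algebra ℚ R] (P : MvPowerSeries (Fin n) R) (k : ℕ) :
    coeffIdeal (traceHessianPow P) k = coeffIdeal (laplacianPow P) k := by
  -- An ideal is determined by the ideals `J` above it; series with all coefficients in `J` form a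
  -- differential ideal.
  refine eq_of_forall_ge_iff fun J => ?_
  rw [coeffIdeal_le_iff, coeffIdeal_le_iff,
    traceHessianPow_mem_iff (pderiv_mem_coeffwiseIdeal J)]

end MvPowerSeries

end

end HessianNilpotent

theorem theorem4p1 (n k : ℕ) :
    HessianNilpotent.differentialIdeal
        (HessianNilpotent.traceHessianPow (HessianNilpotent.universalSeries n)) k =
      HessianNilpotent.differentialIdeal
        (HessianNilpotent.laplacianPow (HessianNilpotent.universalSeries n)) k ∧
    HessianNilpotent.coeffIdeal
        (HessianNilpotent.traceHessianPow (HessianNilpotent.universalSeries n)) k =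
      HessianNilpotent.coeffIdeal
        (HessianNilpotent.laplacianPow (HessianNilpotent.universalSeries n)) k :=
  ⟨HessianNilpotent.differentialIdeal_traceHessianPow _ k,
    HessianNilpotent.coeffIdeal_traceHessianPow _ k⟩
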